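/- Let $n$ be a natural number and let $\Phi : M_n(\mathbb{R}) \to M_n(\mathbb{R})$ be a linear map such that 1. $\Phi$ is unital, $\Phi(I_n) = I_n$, and trace preserving, $\operatorname{Tr}\Phi(X) = \operatorname{Tr} X$ for all $X \in M_n(\mathbb{R})$; 2. $\Phi$ is completely positive, that is, for every $p\in\mathbb{N}$ the map $\Phi \otimes \mathrm{id}_p$ on $M_n(\mathbb{R}) \otimes M_p(\mathbb{R})$ maps positive semidefinite matrices to positive semidefinite matrices and commutes with the transpose; 3. $\Phi$ is IPT (invariant under partial transpose): its Choi matrix $C_\Phi = \sum_{i,j=1}^n E_{ij} \otimes \Phi(E_{ij})$, which is positive semidefinite, satisfies $(\tau_n \otimes \mathrm{id}_n)(C_\Phi) = C_\Phi$, where $\tau_n(A) = A^t$ is the transpose map on $M_n(\mathbb{R})$. Then there is an integer $k \ge 1$ such that the $k$-fold composition $\Phi^k = \Phi \circ \dots \circ \Phi$ is $\mathbb{R}$-entanglement breaking: for every $r \ge 1$ and every positive semidefinite $P \in M_n(\mathbb{R}) \otimes M_r(\mathbb{R})$, the matrix $(\Phi^k \otimes \mathrm{id}_r)(P)$ is $\mathbb{R}$-separable,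 that is, it is a finite sum $\sum_i A_i \otimes B_i$ with real positive semidefinite $A_i \in M_n(\mathbb{R})$ and $B_i \in M_r(\mathbb{R})$. -/

import Mathlib

open scoped Kronecker

namespace RealIPT

/-- The linear map `Φ ⊗ id_r : M_n(ℝ) ⊗ M_r(ℝ) → M_m(ℝ) ⊗ M_r(ℝ)`. The space `M_n(ℝ) ⊗ M_r(ℝ)` is
identified, through the Kronecker product, with the matrices indexed by `Fin n × Fin r`, and
`Φ` acts on each of the `n × n` blocks `(P ((i, s), (j, t)))_{i, j}`. See `tensorId_kronecker`. -/
def tensorId {n m : ℕ} (Φ : Matrix (Fin n) (Fin n) ℝ →ₗ[ℝ] Matrix (Fin m) (Fin m) ℝ) (r : ℕ) :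
    Matrix (Fin n × Fin r) (Fin n × Fin r) ℝ →ₗ[ℝ]
      Matrix (Fin m × Fin r) (Fin m × Fin r) ℝ where
  toFun P := Matrix.of fun a b =>
    Φ (Matrix.of fun i j => P (i, a.2) (j, b.2)) a.1 b.1
  map_add' P Q := by
    ext a b
    have h : (Matrix.of fun i j => (P + Q) (i, a.2) (j, b.2)) =
        (Matrix.of fun i j => P (i, a.2) (j, b.2)) +
          (Matrix.of fun i j => Q (i, a.2) (j, b.2)) := by
      ext i j; rfl
    have h2 := congrArg (fun M => M a.1 b.1) ((congrArg Φ h).trans (map_add Φ _ _))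
    exact h2
  map_smul' c P := by
    ext a b
    have h : (Matrix.of fun i j => (c • P) (i, a.2) (j, b.2)) =
        c • (Matrix.of fun i j => P (i, a.2) (j, b.2)) := by
      ext i j; rfl
    have h2 := congrArg (fun M => M a.1 b.1) ((congrArg Φ h).trans (map_smul Φ c _))
    exact h2

/-- `tensorId Φ r` is the map determined by `A ⊗ B ↦ Φ(A) ⊗ B`. -/
theorem tensorId_kronecker {n m : ℕ}
    (Φ : Matrix (Fin n) (Fin n) ℝ →ₗ[ℝ] Matrix (Fin m) (Fin m) ℝ) (r : ℕ)
    (A : Matrix (Fin n) (Fin n) ℝ) (B : Matrix (Fin r) (Fin r) ℝ) :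
    tensorId Φ r (A ⊗ₖ B) = Φ A ⊗ₖ B := by
  ext a b
  have h : (Matrix.of fun i j => (A ⊗ₖ B) (i, a.2) (j, b.2)) = B a.2 b.2 • A := by
    ext i j
    simp [Matrix.kroneckerMap_apply, mul_comm]
  change Φ (Matrix.of fun i j => (A ⊗ₖ B) (i, a.2) (j, b.2)) a.1 b.1 = _
  rw [h]
  simp [Matrix.kroneckerMap_apply, mul_comm]

/-- A linear map between real matrix algebras is positive if it preserves positive semidefinite
matrices and commutes with the adjoint (the transpose, over `ℝ`). -/
def IsPositiveMap {ι κ : Type*} (Ψ : Matrix ι ι ℝ →ₗ[ℝ] Matrix κ κ ℝ) : Prop :=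
  (∀ P : Matrix ι ι ℝ, P.PosSemidef → (Ψ P).PosSemidef) ∧
    ∀ A : Matrix ι ι ℝ, Ψ A.transpose = (Ψ A).transpose

/-- `Φ` is completely positive if `Φ ⊗ id_p` is positive for every `p`. -/
def IsCompletelyPositive {n m : ℕ}
    (Φ : Matrix (Fin n) (Fin n) ℝ →ₗ[ℝ] Matrix (Fin m) (Fin m) ℝ) : Prop :=
  ∀ p : ℕ, IsPositiveMap (tensorId Φ p)

/-- The Choi matrix `C_Φ = ∑_{i,j} E_{ij} ⊗ Φ(E_{ij})`. -/
def choi {n m : ℕ} (Φ : Matrix (Fin n) (Fin n) ℝ →ₗ[ℝ] Matrix (Fin m) (Fin m) ℝ) :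
    Matrix (Fin n × Fin m) (Fin n × Fin m) ℝ :=
  ∑ i : Fin n, ∑ j : Fin n,
    (Matrix.single i j (1 : ℝ) : Matrix (Fin n) (Fin n) ℝ) ⊗ₖ
      Φ (Matrix.single i j (1 : ℝ))

/-- The partial transpose `(τ_n ⊗ id_m)(P)`, with `τ_n` the transpose map on `M_n(ℝ)`. -/
def partialTranspose {n m : ℕ} (P : Matrix (Fin n × Fin m) (Fin n × Fin m) ℝ) :
    Matrix (Fin n × Fin m) (Fin n × Fin m) ℝ :=
  Matrix.of fun a b => P (b.1, a.2) (a.1, b.2)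

/-- The partial transpose sends `A ⊗ B` to `Aᵗ ⊗ B`. -/
theorem partialTranspose_kronecker {n m : ℕ}
    (A : Matrix (Fin n) (Fin n) ℝ) (B : Matrix (Fin m) (Fin m) ℝ) :
    partialTranspose (A ⊗ₖ B) = A.transpose ⊗ₖ B := rfl

/-- A positive semidefinite matrix is IPT if it is invariant under partial transpose. -/
def IsIPTMatrix {n m : ℕ} (P : Matrix (Fin n × Fin m) (Fin n × Fin m) ℝ) : Prop :=
  P.PosSemidef ∧ partialTranspose P = P

/-- A completely positive map is IPT if its Choi matrix is IPT. -/
def IsIPT {n m : ℕ} (Φ : Matrix (Fin n) (Fin n) ℝ →ₗ[ℝ] Matrix (Fin m) (Fin m) ℝ) : Prop :=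
  IsCompletelyPositive Φ ∧ IsIPTMatrix (choi Φ)

/-- The cone of `ℝ`-separable matrices: finite sums `∑ A_i ⊗ B_i` with `A_i` and `B_i` real positive
semidefinite matrices. -/
def IsSeparable {n m : ℕ} (P : Matrix (Fin n × Fin m) (Fin n × Fin m) ℝ) : Prop :=
  ∃ (k : ℕ) (A : Fin k → Matrix (Fin n) (Fin n) ℝ) (B : Fin k → Matrix (Fin m) (Fin m) ℝ),
    (∀ i, (A i).PosSemidef) ∧ (∀ i, (B i).PosSemidef) ∧ P = ∑ i, A i ⊗ₖ B i

/-- `Φ` is `ℝ`-entanglement breaking if `Φ ⊗ id_r` maps every positive semidefinite matrix to a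
separable one, for every `r ≥ 1`. -/
def IsEntanglementBreaking {n m : ℕ}
    (Φ : Matrix (Fin n) (Fin n) ℝ →ₗ[ℝ] Matrix (Fin m) (Fin m) ℝ) : Prop :=
  ∀ r : ℕ, 1 ≤ r → ∀ P : Matrix (Fin n × Fin r) (Fin n × Fin r) ℝ,
    P.PosSemidef → IsSeparable (tensorId Φ r P)

end RealIPT

/-! IPT makes `Φ` invariant under the transpose, and a Kraus map commutes with the transpose, so
every value of `Φ` is symmetric. By the Kadison-Schwarz identity `Φ` contracts the Hilbert-Schmidt
norm, so some sequence of its powers converges to an idempotent `E`. On the range of `E` the norm is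
preserved. Equality in Kadison-Schwarz then makes `Φ` multiplicative there, and in the limit `E (x *
y) = x * E y` for `x` in the range. The range is thus an algebra of symmetric matrices, hence
commutative. In an orthonormal eigenbasis it consists of the diagonal matrices constant on the
blocks of a partition, and `E X` is the sum over blocks of `Tr(P X) P / Tr P`, with `P` the block
projection: a Holevo form.

Closeness to `E` alone does not suffice, since `E` can lie on the boundary of the Holevo cone. But a
power `K` near `E` maps block projections to nearby projections of the same algebra, so it fixes
them; multiplicativity then makes `K` block diagonal. Inside a block the coefficients of `E` are
strictly positive and absorb a small symmetric error (`mem_holevoCone_of_near`,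
`IsDiagExpectation.mem_holevoCone`, `exists_pow_mem_holevoCone`). -/

open scoped Kronecker

namespace RealIPT

open Matrix

/-! ### The Holevo cone and entanglement breaking -/

/-- The map `X ↦ Tr(A X) B`. -/
noncomputable def traceSmul {n : ℕ} (A B : Matrix (Fin n) (Fin n) ℝ) :
    Module.End ℝ (Matrix (Fin n) (Fin n) ℝ) :=
  ((traceLinearMap (Fin n) ℝ ℝ).comp (LinearMap.mulLeft ℝ A)).smulRight B

theorem traceSmul_apply {n : ℕ} (A B X : Matrix (Fin n) (Fin n) ℝ) :
    traceSmul A B X = (A * X).trace • B := rfl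

/-- The cone of maps in Holevo form: finite sums of maps `X ↦ Tr(A X) B` with `A`, `B` positive
semidefinite. -/
def holevoCone (n : ℕ) : AddSubmonoid (Module.End ℝ (Matrix (Fin n) (Fin n) ℝ)) :=
  AddSubmonoid.closure {Ψ | ∃ A B : Matrix (Fin n) (Fin n) ℝ,
    A.PosSemidef ∧ B.PosSemidef ∧ Ψ = traceSmul A B}

theorem traceSmul_mem {n : ℕ} {A B : Matrix (Fin n) (Fin n) ℝ} (hA : A.PosSemidef)
    (hB : B.PosSemidef) : traceSmul A B ∈ holevoCone n :=
  AddSubmonoid.subset_closure ⟨A, B, hA, hB, rfl⟩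

theorem smul_mem_holevoCone {n : ℕ} {Ψ : Module.End ℝ (Matrix (Fin n) (Fin n) ℝ)} {c : ℝ}
    (hc : 0 ≤ c) (h : Ψ ∈ holevoCone n) : c • Ψ ∈ holevoCone n := by
  induction h using AddSubmonoid.closure_induction with
  | mem Ψ h =>
    obtain ⟨A, B, hA, hB, rfl⟩ := h
    have : c • traceSmul A B = traceSmul A (c • B) := by
      ext X : 1
      simp [traceSmul_apply, smul_smul, mul_comm]
    rw [this]
    exact traceSmul_mem hA (hB.smul hc)
  | zero => simp
  | add Ψ Ψ' _ _ h h' => rw [smul_add]; exact add_mem h h'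

theorem isSeparable_kronecker {n m : ℕ} {A : Matrix (Fin n) (Fin n) ℝ}
    {B : Matrix (Fin m) (Fin m) ℝ} (hA : A.PosSemidef) (hB : B.PosSemidef) :
    IsSeparable (A ⊗ₖ B) :=
  ⟨1, fun _ => A, fun _ => B, fun _ => hA, fun _ => hB, by simp⟩

theorem isSeparable_zero {n m : ℕ} :
    IsSeparable (0 : Matrix (Fin n × Fin m) (Fin n × Fin m) ℝ) :=
  ⟨0, fun _ => 0, fun _ => 0, fun i => i.elim0, fun i => i.elim0, by simp⟩

theorem IsSeparable.add {n m : ℕ} {P Q : Matrix (Fin n × Fin m) (Fin n × Fin m) ℝ}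
    (hP : IsSeparable P) (hQ : IsSeparable Q) : IsSeparable (P + Q) := by
  obtain ⟨k, A, B, hA, hB, rfl⟩ := hP
  obtain ⟨l, A', B', hA', hB', rfl⟩ := hQ
  refine ⟨k + l, Fin.append A A', Fin.append B B', fun i => ?_, fun i => ?_, ?_⟩
  · induction i using Fin.addCases <;> simp [hA, hA']
  · induction i using Fin.addCases <;> simp [hB, hB']
  · simp [Fin.sum_univ_add]

/-- The partial contraction of a positive semidefinite matrix against a positive semidefinite
matrix is positive semidefinite. -/
theorem posSemidef_partial_trace_mul {n r : ℕ} {A : Matrix (Fin n) (Fin n) ℝ} (hA : A.PosSemidef)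
    {P : Matrix (Fin n × Fin r) (Fin n × Fin r) ℝ} (hP : P.PosSemidef) :
    (Matrix.of fun s t => (A * Matrix.of fun i j => P (i, s) (j, t)).trace :
      Matrix (Fin r) (Fin r) ℝ).PosSemidef := by
  obtain ⟨C, rfl⟩ : ∃ C : Matrix (Fin n) (Fin n) ℝ, A = Cᴴ * C := by
    open scoped MatrixOrder in
    exact CStarAlgebra.nonneg_iff_eq_star_mul_self.mp hA.nonneg
  -- Each row of `C` gives a compression of `P` by (row ⊗ identity); the contraction against `Cᴴ *
  -- C` is the sum of these compressions.
  have key : (Matrix.of fun s t => ((Cᴴ * C) * Matrix.of fun i j => P (i, s) (j, t)).trace :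
      Matrix (Fin r) (Fin r) ℝ) =
      ∑ m, (Matrix.of fun (a : Fin n × Fin r) t => if a.2 = t then C m a.1 else 0)ᴴ * P *
        (Matrix.of fun (a : Fin n × Fin r) t => if a.2 = t then C m a.1 else 0) := by
    ext s t
    simp only [Matrix.sum_apply, Matrix.trace, Matrix.diag, Matrix.mul_apply, Matrix.of_apply,
      Matrix.conjTranspose_apply, star_trivial, Fintype.sum_prod_type, ite_mul, mul_ite, zero_mul,
      mul_zero, Finset.sum_ite_eq', Finset.mem_univ, if_true]
    simp only [Finset.sum_mul]
    refine (Finset.sum_congr rfl fun i _ => Finset.sum_comm).trans (Finset.sum_comm.trans ?_)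
    refine Finset.sum_congr rfl fun m _ => Finset.sum_congr rfl fun i _ =>
      Finset.sum_congr rfl fun j _ => ?_
    ring
  rw [key]
  exact Matrix.posSemidef_sum _ fun m _ => hP.conjTranspose_mul_mul_same _

/-- A generator contracts the first tensor factor of `P` against `A` and puts `B` in its place,
which leaves a product of two positive semidefinite matrices. -/
theorem isEntanglementBreaking_of_mem_holevoCone {n : ℕ}
    {Ψ : Module.End ℝ (Matrix (Fin n) (Fin n) ℝ)} (h : Ψ ∈ holevoCone n) :
    IsEntanglementBreaking Ψ := by
  intro r hr P hP
  induction h using AddSubmonoid.closure_induction with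
  | mem Ψ h =>
    obtain ⟨A, B, hA, hB, rfl⟩ := h
    have : tensorId (traceSmul A B) r P =
        B ⊗ₖ (Matrix.of fun s t => (A * Matrix.of fun i j => P (i, s) (j, t)).trace) := by
      ext a b
      change (A * Matrix.of fun i j => P (i, a.2) (j, b.2)).trace * B a.1 b.1 = _
      rw [mul_comm]
      rfl
    rw [this]
    exact isSeparable_kronecker hB (posSemidef_partial_trace_mul hA hP)
  | zero => exact isSeparable_zero
  | add Ψ Ψ' _ _ h h' => exact h.add h'

/-- The Holevo cone is invariant under orthogonal conjugation. -/
theorem mem_holevoCone_of_conj {n : ℕ} {U : Matrix (Fin n) (Fin n) ℝ} (hU : U * Uᵀ = 1)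
    {Ψ Ψ' : Module.End ℝ (Matrix (Fin n) (Fin n) ℝ)} (h : Ψ' ∈ holevoCone n)
    (hΨ : ∀ X, Ψ' X = Uᵀ * Ψ (U * X * Uᵀ) * U) : Ψ ∈ holevoCone n := by
  have h0 : ∀ X, Ψ X = U * Ψ' (Uᵀ * X * U) * Uᵀ := by
    intro X
    have e1 : U * (Uᵀ * X * U) * Uᵀ = (U * Uᵀ) * X * (U * Uᵀ) := by noncomm_ring
    have e2 : ∀ Y, U * (Uᵀ * Y * U) * Uᵀ = (U * Uᵀ) * Y * (U * Uᵀ) := by intro Y; noncomm_ring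
    rw [hΨ, e2, e1, hU]; simp
  clear hΨ
  induction h using AddSubmonoid.closure_induction generalizing Ψ with
  | mem Ψ' h =>
    obtain ⟨A, B, hA, hB, rfl⟩ := h
    have : Ψ = traceSmul (U * A * Uᵀ) (U * B * Uᵀ) := by
      ext X : 1
      rw [h0, traceSmul_apply, traceSmul_apply, Matrix.mul_smul, Matrix.smul_mul]
      congr 1
      rw [← mul_assoc, ← mul_assoc, Matrix.trace_mul_comm]
      simp only [mul_assoc]
    rw [this]
    exact traceSmul_mem (hA.mul_mul_conjTranspose_same U) (hB.mul_mul_conjTranspose_same U)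
  | zero =>
    have : Ψ = 0 := by ext X : 1; simp [h0]
    rw [this]; exact zero_mem _
  | add Ψ₁ Ψ₂ _ _ h₁ h₂ =>
    -- The conjugation that recovers `Ψ` from `Ψ'` is linear, so it splits along the sum.
    let c : Module.End ℝ (Matrix (Fin n) (Fin n) ℝ) →
        Module.End ℝ (Matrix (Fin n) (Fin n) ℝ) := fun Θ =>
      (LinearMap.mulRight ℝ Uᵀ ∘ₗ LinearMap.mulLeft ℝ U) ∘ₗ Θ ∘ₗ
        (LinearMap.mulRight ℝ U ∘ₗ LinearMap.mulLeft ℝ Uᵀ)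
    have : Ψ = c Ψ₁ + c Ψ₂ := by
      ext X : 1
      simp [c, h0, mul_add, add_mul]
    rw [this]
    exact add_mem (h₁ fun X => by simp [c]) (h₂ fun X => by simp [c])

/-! ### Absorbing small symmetric perturbations -/

/-- The symmetrized matrix unit `E_{ab} + E_{ba}`. -/
def symmUnit {n : ℕ} (a b : Fin n) : Matrix (Fin n) (Fin n) ℝ :=
  Matrix.single a b 1 + Matrix.single b a 1

/-- The diagonal matrix `E_{aa} + E_{bb}`. -/
def diagUnit {n : ℕ} (a b : Fin n) : Matrix (Fin n) (Fin n) ℝ :=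
  Matrix.single a a 1 + Matrix.single b b 1

theorem posSemidef_single_self {n : ℕ} (a : Fin n) :
    (Matrix.single a a 1 : Matrix (Fin n) (Fin n) ℝ).PosSemidef := by
  have := Matrix.posSemidef_vecMulVec_self_star (R := ℝ) (Pi.single a 1 : Fin n → ℝ)
  convert this using 1
  ext i j
  simp [Matrix.vecMulVec_apply, Matrix.single_apply, Pi.single_apply, ite_and, eq_comm]
  split_ifs <;> rfl

theorem posSemidef_diagUnit_add {n : ℕ} (a b : Fin n) :
    (diagUnit a b + symmUnit a b).PosSemidef := by
  have := Matrix.posSemidef_vecMulVec_self_star (R := ℝ)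
    (Pi.single a 1 + Pi.single b 1 : Fin n → ℝ)
  convert this using 1
  ext i j
  simp only [diagUnit, symmUnit, Matrix.add_apply, Matrix.vecMulVec_apply, Matrix.single_apply,
    Pi.single_apply, Pi.add_apply, star_trivial, eq_comm (a := a), eq_comm (a := b), ite_and]
  split_ifs <;> norm_num

theorem posSemidef_diagUnit_sub {n : ℕ} (a b : Fin n) :
    (diagUnit a b - symmUnit a b).PosSemidef := by
  have := Matrix.posSemidef_vecMulVec_self_star (R := ℝ)
    (Pi.single a 1 - Pi.single b 1 : Fin n → ℝ)
  convert this using 1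
  ext i j
  simp only [diagUnit, symmUnit, Matrix.add_apply, Matrix.sub_apply, Matrix.vecMulVec_apply,
    Matrix.single_apply, Pi.single_apply, Pi.sub_apply, star_trivial, eq_comm (a := a),
    eq_comm (a := b), ite_and]
  split_ifs <;> norm_num

theorem traceSmul_add_left {n : ℕ} (A A' B : Matrix (Fin n) (Fin n) ℝ) :
    traceSmul (A + A') B = traceSmul A B + traceSmul A' B := by
  ext X : 1; simp [traceSmul_apply, add_mul, add_smul]

theorem traceSmul_add_right {n : ℕ} (A B B' : Matrix (Fin n) (Fin n) ℝ) :
    traceSmul A (B + B') = traceSmul A B + traceSmul A B' := by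
  ext X : 1; simp [traceSmul_apply]

theorem traceSmul_sub_left {n : ℕ} (A A' B : Matrix (Fin n) (Fin n) ℝ) :
    traceSmul (A - A') B = traceSmul A B - traceSmul A' B := by
  ext X : 1; simp [traceSmul_apply, sub_mul, sub_smul]

theorem traceSmul_sub_right {n : ℕ} (A B B' : Matrix (Fin n) (Fin n) ℝ) :
    traceSmul A (B - B') = traceSmul A B - traceSmul A B' := by
  ext X : 1; simp [traceSmul_apply, smul_sub]

/-- The diagonal term pays for a symmetric term of either sign, because `diagUnit ± symmUnit` are
both positive semidefinite: equal signs carry weight `(ε + δ) / 4`, opposite signs `(ε - δ) / 4`. -/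
theorem traceSmul_diagUnit_add_mem {n : ℕ} {ε δ : ℝ} (h : |δ| ≤ ε) (a b d e : Fin n) :
    ε • traceSmul (diagUnit a b) (diagUnit d e) + δ • traceSmul (symmUnit a b) (symmUnit d e) ∈
      holevoCone n := by
  have h1 := abs_le.mp h
  have e1 : ε • traceSmul (diagUnit a b) (diagUnit d e) +
      δ • traceSmul (symmUnit a b) (symmUnit d e) =
      ((ε + δ) / 4) • traceSmul (diagUnit a b + symmUnit a b) (diagUnit d e + symmUnit d e) +
      ((ε + δ) / 4) • traceSmul (diagUnit a b - symmUnit a b) (diagUnit d e - symmUnit d e) +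
      (((ε - δ) / 4) • traceSmul (diagUnit a b + symmUnit a b) (diagUnit d e - symmUnit d e) +
      ((ε - δ) / 4) • traceSmul (diagUnit a b - symmUnit a b) (diagUnit d e + symmUnit d e)) := by
    simp only [traceSmul_add_left, traceSmul_add_right, traceSmul_sub_left, traceSmul_sub_right]
    module
  rw [e1]
  have p := posSemidef_diagUnit_add (n := n)
  have q := posSemidef_diagUnit_sub (n := n)
  refine add_mem (add_mem ?_ ?_) (add_mem ?_ ?_)
  · exact smul_mem_holevoCone (by linarith) (traceSmul_mem (p a b) (p d e))
  · exact smul_mem_holevoCone (by linarith) (traceSmul_mem (q a b) (q d e))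
  · exact smul_mem_holevoCone (by linarith) (traceSmul_mem (p a b) (q d e))
  · exact smul_mem_holevoCone (by linarith) (traceSmul_mem (q a b) (p d e))

theorem sum_smul_symmUnit {n : ℕ} {M : Matrix (Fin n) (Fin n) ℝ} (hM : Mᵀ = M) :
    ∑ d, ∑ e, M d e • symmUnit d e = (2 : ℝ) • M := by
  have h1 : ∀ N : Matrix (Fin n) (Fin n) ℝ, ∑ d, ∑ e, N d e • Matrix.single d e (1 : ℝ) = N := by
    intro N
    conv_rhs => rw [Matrix.matrix_eq_sum_single N]
    simp [Matrix.smul_single]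
  simp only [symmUnit, smul_add, Finset.sum_add_distrib, h1]
  rw [Finset.sum_comm, two_smul]
  congr 1
  conv_rhs => rw [← hM, ← h1 Mᵀ]
  rfl

/-- The trace is `X b a + X a b`, so the sum is `Ψ Xᵀ + Ψ X`; transpose invariance merges the two.
-/
theorem sum_trace_symmUnit_smul {n : ℕ} {Ψ : Module.End ℝ (Matrix (Fin n) (Fin n) ℝ)}
    (hT : ∀ X, Ψ Xᵀ = Ψ X) (X : Matrix (Fin n) (Fin n) ℝ) :
    ∑ a, ∑ b, (symmUnit a b * X).trace • Ψ (Matrix.single a b 1) = (2 : ℝ) • Ψ X := by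
  have h1 : ∀ N : Matrix (Fin n) (Fin n) ℝ, ∑ d, ∑ e, N d e • Ψ (Matrix.single d e (1 : ℝ)) =
      Ψ N := by
    intro N
    conv_rhs => rw [Matrix.matrix_eq_sum_single N]
    simp only [map_sum, ← map_smul, Matrix.smul_single, smul_eq_mul, mul_one]
  have h2 : ∀ a b, (symmUnit a b * X).trace = Xᵀ a b + X a b := by
    intro a b
    simp [symmUnit, add_mul, Matrix.trace_single_mul]
  simp only [h2, add_smul, Finset.sum_add_distrib, h1, hT, two_smul]

/-- Expansion of a map with symmetric values that is invariant under the transpose. -/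
theorem eq_sum_smul_traceSmul_symmUnit {n : ℕ} {Ψ : Module.End ℝ (Matrix (Fin n) (Fin n) ℝ)}
    (hT : ∀ X, Ψ Xᵀ = Ψ X) (hS : ∀ X, (Ψ X)ᵀ = Ψ X) :
    Ψ = (1 / 4 : ℝ) • ∑ a, ∑ b, ∑ d, ∑ e,
      Ψ (Matrix.single a b 1) d e • traceSmul (symmUnit a b) (symmUnit d e) := by
  ext X : 1
  have h1 : ∀ a b, ∑ d, ∑ e,
      (Ψ (Matrix.single a b 1) d e • traceSmul (symmUnit a b) (symmUnit d e)) X =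
      (2 : ℝ) • ((symmUnit a b * X).trace • Ψ (Matrix.single a b 1)) := by
    intro a b
    rw [smul_comm, ← sum_smul_symmUnit (hS _)]
    simp only [Finset.smul_sum, LinearMap.smul_apply, traceSmul_apply]
    exact Finset.sum_congr rfl fun d _ => Finset.sum_congr rfl fun e _ => smul_comm _ _ _
  simp only [LinearMap.smul_apply, LinearMap.sum_apply] at h1 ⊢
  simp only [h1]
  simp_rw [← Finset.smul_sum]
  rw [sum_trace_symmUnit_smul hT]
  module

/-! ### Sums over quadruples of indices in one block -/

section ClassSums

variable {n : ℕ} {Q M : Type*} [AddCommGroup M]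

open Classical in
theorem sum_same_class_comm_left (f : Fin n → Q) (F : Fin n → Fin n → M) :
    ∑ a, ∑ b, ∑ d, ∑ e, (if f a = f b ∧ f a = f d ∧ f a = f e then F b d else 0) =
      ∑ a, ∑ b, ∑ d, ∑ e, if f a = f b ∧ f a = f d ∧ f a = f e then F a d else 0 := by
  rw [Finset.sum_comm]
  refine Finset.sum_congr rfl fun b _ => Finset.sum_congr rfl fun a _ =>
    Finset.sum_congr rfl fun d _ => Finset.sum_congr rfl fun e _ => ?_
  refine if_congr ?_ rfl rfl
  constructor <;> rintro ⟨h1, h2, h3⟩ <;> simp_all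

open Classical in
theorem sum_same_class_comm_right (f : Fin n → Q) (F : Fin n → Fin n → M) :
    ∑ a, ∑ b, ∑ d, ∑ e, (if f a = f b ∧ f a = f d ∧ f a = f e then F a e else 0) =
      ∑ a, ∑ b, ∑ d, ∑ e, if f a = f b ∧ f a = f d ∧ f a = f e then F a d else 0 := by
  refine Finset.sum_congr rfl fun a _ => Finset.sum_congr rfl fun b _ => ?_
  rw [Finset.sum_comm]
  refine Finset.sum_congr rfl fun d _ => Finset.sum_congr rfl fun e _ => ?_
  exact if_congr (by tauto) rfl rfl

-- The indices `b` and `e` range freely over the block of `a`, whence the square of its size.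
open Classical in
theorem sum_same_class [Module ℝ M] (f : Fin n → Q) (F : Fin n → Fin n → M) :
    ∑ a, ∑ b, ∑ d, ∑ e, (if f a = f b ∧ f a = f d ∧ f a = f e then F a d else 0) =
      ∑ a, ∑ d, if f a = f d then ((Finset.univ.filter fun b => f a = f b).card : ℝ) ^ 2 • F a d
        else 0 := by
  refine Finset.sum_congr rfl fun a _ => ?_
  rw [Finset.sum_comm]
  refine Finset.sum_congr rfl fun d _ => ?_
  by_cases h : f a = f d
  · simp only [h, true_and, ite_and, if_true]
    simp only [Finset.sum_ite_irrel, Finset.sum_const_zero, ← Finset.sum_filter, Finset.sum_const]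
    rw [← Nat.cast_smul_eq_nsmul ℝ, ← Nat.cast_smul_eq_nsmul ℝ, smul_smul, sq]
  · simp [h]

end ClassSums

-- This is the total cost of absorbing the errors. Each product of diagonal units expands into four
-- terms, whose sums agree after relabelling indices within a block.
open Classical in
theorem sum_same_class_traceSmul_diagUnit {n : ℕ} {Q : Type*} (f : Fin n → Q) :
    ∑ a, ∑ b, ∑ d, ∑ e, (if f a = f b ∧ f a = f d ∧ f a = f e then
        traceSmul (diagUnit a b) (diagUnit d e) else 0) =
      (4 : ℝ) • ∑ a, ∑ d, if f a = f d then
        ((Finset.univ.filter fun b => f a = f b).card : ℝ) ^ 2 •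
          traceSmul (Matrix.single a a 1) (Matrix.single d d 1) else 0 := by
  set F : Fin n → Fin n → Module.End ℝ (Matrix (Fin n) (Fin n) ℝ) := fun a d =>
    traceSmul (Matrix.single a a 1) (Matrix.single d d 1) with hF
  have h1 : ∀ a b d e : Fin n, traceSmul (diagUnit a b) (diagUnit d e) =
      F a d + F b d + (F a e + F b e) := by
    intro a b d e
    simp only [hF, diagUnit, traceSmul_add_left, traceSmul_add_right]
  have h2 : ∀ (p : Prop) [Decidable p] (x y : Module.End ℝ (Matrix (Fin n) (Fin n) ℝ)),
      (if p then x + y else 0) = (if p then x else 0) + if p then y else 0 := by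
    intro p _ x y; split_ifs <;> simp
  have h3 := sum_same_class_comm_left f F
  have h4 := sum_same_class_comm_right f F
  have h5 : ∑ a, ∑ b, ∑ d, ∑ e, (if f a = f b ∧ f a = f d ∧ f a = f e then F b e else 0) =
      ∑ a, ∑ b, ∑ d, ∑ e, if f a = f b ∧ f a = f d ∧ f a = f e then F a d else 0 := by
    rw [← h3]
    refine Finset.sum_congr rfl fun a _ => Finset.sum_congr rfl fun b _ => ?_
    rw [Finset.sum_comm]
    exact Finset.sum_congr rfl fun d _ => Finset.sum_congr rfl fun e _ =>
      if_congr (by tauto) rfl rfl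
  simp only [h1, h2, Finset.sum_add_distrib, h3, h4, h5, sum_same_class]
  module

open Classical in
/-- A transpose invariant map with symmetric values, block diagonal for the partition into the
fibres of `f` and close to the trace preserving conditional expectation onto the matrices that are
constant on each block, lies in the Holevo cone. -/
theorem mem_holevoCone_of_near {n : ℕ} {Q : Type*} (f : Fin n → Q)
    {Ψ : Module.End ℝ (Matrix (Fin n) (Fin n) ℝ)}
    (hT : ∀ X, Ψ Xᵀ = Ψ X) (hS : ∀ X, (Ψ X)ᵀ = Ψ X)
    (hsupp : ∀ a b d e, ¬(f a = f b ∧ f a = f d ∧ f a = f e) → Ψ (Matrix.single a b 1) d e = 0)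
    {ε : ℝ} (hε : ε * (n : ℝ) ^ 3 ≤ 1)
    (hnear : ∀ a b d e, f a = f b → f a = f d → f a = f e →
      |Ψ (Matrix.single a b 1) d e - (if a = b ∧ d = e then
        ((Finset.univ.filter fun b => f a = f b).card : ℝ)⁻¹ else 0)| ≤ ε) :
    Ψ ∈ holevoCone n := by
  set N : Fin n → ℝ := fun a => ((Finset.univ.filter fun b => f a = f b).card : ℝ) with hN
  have hN1 : ∀ a, 1 ≤ N a := fun a => by
    simp only [hN]
    exact_mod_cast Finset.card_pos.mpr ⟨a, by simp⟩
  have hNn : ∀ a, N a ≤ n := fun a => by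
    simp only [hN]
    exact_mod_cast (Finset.card_le_univ _).trans (by simp)
  set F : Fin n → Fin n → Module.End ℝ (Matrix (Fin n) (Fin n) ℝ) := fun a d =>
    traceSmul (Matrix.single a a 1) (Matrix.single d d 1) with hF
  set δ : Fin n → Fin n → Fin n → Fin n → ℝ := fun a b d e =>
    Ψ (Matrix.single a b 1) d e - if a = b ∧ d = e then (N a)⁻¹ else 0 with hδ
  -- A term `ε • traceSmul (diagUnit a b) (diagUnit d e)` is added to each error and subtracted
  -- again from the expectation. After the factor `1 / 4` the cost is `ε * N a ^ 2`, which the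
  -- coefficient `(N a)⁻¹` covers as soon as `ε * N a ^ 3 ≤ 1`.
  have hdecomp : Ψ = (1 / 4 : ℝ) • (∑ a, ∑ b, ∑ d, ∑ e,
      if f a = f b ∧ f a = f d ∧ f a = f e then
        ε • traceSmul (diagUnit a b) (diagUnit d e) +
          δ a b d e • traceSmul (symmUnit a b) (symmUnit d e) else 0) +
      ∑ a, ∑ d, if f a = f d then ((N a)⁻¹ - ε * N a ^ 2) • F a d else 0 := by
    have e1 : ∀ a b d e, Ψ (Matrix.single a b 1) d e • traceSmul (symmUnit a b) (symmUnit d e) =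
        (if f a = f b ∧ f a = f d ∧ f a = f e then
        ε • traceSmul (diagUnit a b) (diagUnit d e) +
          δ a b d e • traceSmul (symmUnit a b) (symmUnit d e) else 0) -
        ε • (if f a = f b ∧ f a = f d ∧ f a = f e then
          traceSmul (diagUnit a b) (diagUnit d e) else 0) +
        (if a = b then if d = e then if f a = f d then (4 * (N a)⁻¹) • F a d else 0 else 0
          else 0) := by
      intro a b d e
      by_cases h : f a = f b ∧ f a = f d ∧ f a = f e
      · simp only [if_pos h, hδ, if_pos h.2.1]
        by_cases hab : a = b
        · by_cases hde : d = e
          · subst hab hde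
            -- `symmUnit a a` is twice the matrix unit, so the product carries a factor 4.
            have : traceSmul (symmUnit a a) (symmUnit d d) = (4 : ℝ) • F a d := by
              simp only [symmUnit, hF, traceSmul_add_left, traceSmul_add_right]
              module
            simp only [this, and_self, if_true]
            module
          · simp only [hab, hde, and_false, if_false, if_true]
            module
        · simp only [hab, false_and, if_false]
          module
      · simp only [if_neg h, hsupp a b d e h, zero_smul, smul_zero, sub_zero, zero_add]
        by_cases hab : a = b
        · by_cases hde : d = e
          · subst hab hde
            have : f a ≠ f d := fun h' => h ⟨rfl, h', h'⟩
            simp [this]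
          · simp [hde]
        · simp [hab]
    have e2 : ∀ (p : Prop) [Decidable p] (x : Module.End ℝ (Matrix (Fin n) (Fin n) ℝ)) (c c' : ℝ),
        (if p then (c - c') • x else 0) = (if p then c • x else 0) - if p then c' • x else 0 := by
      intro p _ x c c'
      by_cases hp : p
      · simp only [if_pos hp]; module
      · simp only [if_neg hp]; module
    have e3 : ∀ (p : Prop) [Decidable p] (x : Module.End ℝ (Matrix (Fin n) (Fin n) ℝ)) (c c' : ℝ),
        (if p then (c * c') • x else 0) = c • if p then c' • x else 0 := by
      intro p _ x c c'; split_ifs <;> simp [mul_smul]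
    conv_lhs => rw [eq_sum_smul_traceSmul_symmUnit hT hS]
    simp only [e1, Finset.sum_add_distrib, Finset.sum_sub_distrib, ← Finset.smul_sum,
      sum_same_class_traceSmul_diagUnit f, Finset.sum_ite_irrel, Finset.sum_const_zero,
      Finset.sum_ite_eq, Finset.mem_univ, if_true, e2, e3]
    module
  rw [hdecomp]
  refine add_mem (smul_mem_holevoCone (by norm_num) ?_) ?_
  · refine sum_mem fun a _ => sum_mem fun b _ => sum_mem fun d _ => sum_mem fun e _ => ?_
    split_ifs with h
    · exact traceSmul_diagUnit_add_mem (hnear a b d e h.1 h.2.1 h.2.2) a b d e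
    · exact zero_mem _
  · refine sum_mem fun a _ => sum_mem fun d _ => ?_
    split_ifs with h
    · refine smul_mem_holevoCone ?_ (traceSmul_mem (posSemidef_single_self a)
        (posSemidef_single_self d))
      have h1 := hN1 a
      have h0 : 0 ≤ ε := (abs_nonneg _).trans (hnear a a a a rfl rfl rfl)
      have h3 : ε * N a ^ 3 ≤ 1 :=
        (mul_le_mul_of_nonneg_left (pow_le_pow_left₀ (by linarith) (hNn a) 3) h0).trans hε
      have : ε * N a ^ 2 ≤ (N a)⁻¹ := by
        rw [← one_div, le_div_iff₀ (by linarith)]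
        linarith
      linarith
    · exact zero_mem _

/-! ### Conditional expectations onto diagonal algebras -/

/-- The hypotheses on an idempotent map `E` whose range is an algebra of diagonal matrices and for
which `E` is a trace preserving conditional expectation. -/
structure IsDiagExpectation {n : ℕ} (E : Module.End ℝ (Matrix (Fin n) (Fin n) ℝ)) : Prop where
  idem : ∀ X, E (E X) = E X
  one : E 1 = 1
  trace : ∀ X, (E X).trace = X.trace
  diag : ∀ X a b, a ≠ b → E X a b = 0
  mul_left : ∀ x y, E x = x → E (x * y) = x * E y

namespace IsDiagExpectation

variable {n : ℕ} {E : Module.End ℝ (Matrix (Fin n) (Fin n) ℝ)}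

/-- The label of the block containing `a`: two indices get the same label if all matrices in the
range of `E` have the same diagonal entries there. -/
def label (E : Module.End ℝ (Matrix (Fin n) (Fin n) ℝ)) (a : Fin n) :
    Matrix (Fin n) (Fin n) ℝ → ℝ := fun X => E X a a

theorem apply_eq_of_label_eq {x : Matrix (Fin n) (Fin n) ℝ} (hx : E x = x) {a b : Fin n}
    (h : label E a = label E b) : x a a = x b b := by
  have := congrFun h x
  simpa only [label, hx] using this

/-- The range is closed under products, so one factor per index `j` with a different label suffices,
as in Lagrange interpolation. -/
theorem exists_separating (hE : IsDiagExpectation E) (a : Fin n) (s : Finset (Fin n)) :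
    ∃ x, E x = x ∧ x a a = 1 ∧ ∀ j ∈ s, label E a ≠ label E j → x j j = 0 := by
  classical
  induction s using Finset.induction_on with
  | empty => exact ⟨1, hE.one, by simp, by simp⟩
  | insert j s hj ih =>
    obtain ⟨x, hx, hxa, hxs⟩ := ih
    by_cases h : label E a = label E j
    · refine ⟨x, hx, hxa, fun i hi hne => ?_⟩
      rcases Finset.mem_insert.mp hi with rfl | hi
      · exact absurd h hne
      · exact hxs i hi hne
    · obtain ⟨X, hX⟩ := Function.ne_iff.mp h
      simp only [label] at hX
      have hd : ∀ (i : Fin n) (z : Matrix (Fin n) (Fin n) ℝ), (x * z) i i = x i i * z i i := by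
        intro i z
        rw [Matrix.mul_apply, Finset.sum_eq_single i]
        · intro b _ hb
          rw [← hx, hE.diag _ _ _ hb.symm, zero_mul]
        · simp
      -- The new factor is affine in `E X`, with value 1 at `a` and 0 at `j`.
      refine ⟨x * ((E X a a - E X j j)⁻¹ • (E X - E X j j • 1)), ?_, ?_, fun i hi hne => ?_⟩
      · rw [hE.mul_left _ _ hx]
        simp [hE.idem, hE.one]
      · rw [hd, hxa]
        simp only [Matrix.smul_apply, Matrix.sub_apply, Matrix.one_apply_eq, smul_eq_mul, mul_one,
          one_mul]
        exact inv_mul_cancel₀ (sub_ne_zero.mpr hX)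
      · rw [hd]
        rcases Finset.mem_insert.mp hi with rfl | hi
        · simp
        · rw [hxs i hi hne, zero_mul]

open Classical in
/-- The indicator of the block of `a`. -/
noncomputable def block (E : Module.End ℝ (Matrix (Fin n) (Fin n) ℝ)) (a : Fin n) :
    Matrix (Fin n) (Fin n) ℝ :=
  Matrix.diagonal fun j => if label E a = label E j then 1 else 0

/-- An element of the range is constant on blocks, so one that separates `a` from all other blocks
must be the indicator. -/
theorem apply_block (hE : IsDiagExpectation E) (a : Fin n) : E (block E a) = block E a := by
  obtain ⟨x, hx, hxa, hxs⟩ := hE.exists_separating a Finset.univ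
  have : block E a = x := by
    ext i j
    by_cases hij : i = j
    · subst hij
      by_cases h : label E a = label E i
      · simp [block, h, ← apply_eq_of_label_eq hx h, hxa]
      · simp [block, h, hxs i (Finset.mem_univ _) h]
    · rw [← hx, hE.diag _ _ _ hij]
      simp [block, hij]
  rw [this, hx]

theorem block_mul_self (a : Fin n) : block E a * block E a = block E a := by
  simp [block]

open Classical in
theorem block_mul_apply (a : Fin n) (X : Matrix (Fin n) (Fin n) ℝ) (d e : Fin n) :
    (block E a * X) d e = if label E a = label E d then X d e else 0 := by
  simp [block, Matrix.diagonal_mul]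

open Classical in
theorem mul_block_apply (a : Fin n) (X : Matrix (Fin n) (Fin n) ℝ) (d e : Fin n) :
    (X * block E a) d e = if label E a = label E e then X d e else 0 := by
  simp [block, Matrix.mul_diagonal]

theorem block_mul_single (a b : Fin n) :
    block E a * Matrix.single a b 1 = Matrix.single a b 1 := by
  ext d e
  rw [block_mul_apply]
  by_cases h : a = d
  · simp [h]
  · simp [h]

theorem single_mul_block (a b : Fin n) :
    Matrix.single a b 1 * block E b = Matrix.single a b 1 := by
  ext d e
  rw [mul_block_apply]
  by_cases h : b = e
  · simp [h]
  · simp [h]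

-- Left multiplicativity confines the image of `single a b 1` to the block of `a`, where its
-- diagonal is constant; trace preservation then fixes the constant.
open Classical in
theorem apply_single (hE : IsDiagExpectation E) {a b d e : Fin n} (had : label E a = label E d) :
    E (Matrix.single a b 1) d e = if a = b ∧ d = e then
      ((Finset.univ.filter fun j => label E a = label E j).card : ℝ)⁻¹ else 0 := by
  by_cases hde : d = e
  · subst hde
    have h1 := hE.mul_left _ (Matrix.single a b 1) (hE.apply_block a)
    rw [block_mul_single] at h1
    have h2 := hE.trace (Matrix.single a b 1)
    rw [h1, Matrix.trace] at h2
    simp only [Matrix.diag, block_mul_apply] at h2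
    have h3 : ∀ j, (if label E a = label E j then E (Matrix.single a b 1) j j else 0) =
        if label E a = label E j then E (Matrix.single a b 1) d d else 0 := by
      intro j
      split_ifs with h
      · exact apply_eq_of_label_eq (hE.idem _) (h.symm.trans had)
      · rfl
    simp only [h3, ← Finset.sum_filter, Finset.sum_const, nsmul_eq_mul] at h2
    have h4 : ((Finset.univ.filter fun j => label E a = label E j).card : ℝ) ≠ 0 := by
      exact_mod_cast (Finset.card_pos.mpr ⟨a, by simp⟩).ne'
    by_cases hab : a = b
    · subst hab
      rw [Matrix.trace_single_eq_same] at h2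
      simp only [and_self, if_true]
      exact eq_inv_of_mul_eq_one_right h2
    · rw [Matrix.trace_single_eq_of_ne _ _ _ hab] at h2
      simpa [hab, h4] using h2
  · simp [hde, hE.diag _ _ _ hde]

end IsDiagExpectation

open IsDiagExpectation in
/-- A map that is close to a conditional expectation `E` onto an algebra of diagonal matrices and
multiplicative on the range of `E` lies in the Holevo cone. -/
theorem IsDiagExpectation.mem_holevoCone {n : ℕ}
    {K E : Module.End ℝ (Matrix (Fin n) (Fin n) ℝ)} (hE : IsDiagExpectation E)
    (hT : ∀ X, K Xᵀ = K X) (hS : ∀ X, (K X)ᵀ = K X)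
    (hKE : ∀ x, E x = x → E (K x) = K x)
    (hKl : ∀ x y, E x = x → K (x * y) = K x * K y)
    (hKr : ∀ x y, E x = x → K (y * x) = K y * K x)
    {ε : ℝ} (hε : ε * (n : ℝ) ^ 3 ≤ 1) (hε' : ε * n < 1)
    (hnear : ∀ a b d e, |K (Matrix.single a b 1) d e - E (Matrix.single a b 1) d e| ≤ ε) :
    K ∈ holevoCone n := by
  classical
  -- `K (block E a)` is an idempotent diagonal matrix, so its diagonal entries are 0 or 1; they
  -- differ from those of `block E a` by less than 1, hence not at all.
  have hblock : ∀ a, K (block E a) = block E a := by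
    intro a
    have hm : K (block E a) * K (block E a) = K (block E a) := by
      rw [← hKl _ _ (hE.apply_block a), block_mul_self]
    have hf := hKE _ (hE.apply_block a)
    ext i j
    by_cases hij : i = j
    · subst hij
      have h1 : K (block E a) i i * K (block E a) i i = K (block E a) i i := by
        conv_rhs => rw [← hm]
        rw [Matrix.mul_apply, Finset.sum_eq_single i]
        · intro b _ hb
          rw [← hf, hE.diag _ _ _ hb.symm, zero_mul]
        · simp
      have h2 : |K (block E a) i i - block E a i i| < 1 := by
        rw [← congrFun (congrFun (hE.apply_block a) i) i]
        -- The indicator is a sum of at most `n` matrix units, so the error is at most `ε * n`.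
        have hsum : block E a = ∑ b, (if label E a = label E b then (1 : ℝ) else 0) •
            Matrix.single b b (1 : ℝ) := by
          rw [block, ← Matrix.sum_single_eq_diagonal]
          refine Finset.sum_congr rfl fun b _ => ?_
          rw [Matrix.smul_single, smul_eq_mul, mul_one]
        have hval : K (block E a) i i - E (block E a) i i =
            ∑ b, (if label E a = label E b then (1 : ℝ) else 0) *
              (K (Matrix.single b b 1) i i - E (Matrix.single b b 1) i i) := by
          rw [hsum, map_sum, map_sum, Matrix.sum_apply, Matrix.sum_apply, ← Finset.sum_sub_distrib]
          refine Finset.sum_congr rfl fun b _ => ?_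
          rw [map_smul, map_smul, Matrix.smul_apply, Matrix.smul_apply, smul_eq_mul, smul_eq_mul,
            mul_sub]
        rw [hval]
        refine (Finset.abs_sum_le_sum_abs _ _).trans_lt ?_
        refine (Finset.sum_le_sum (g := fun _ => ε) fun b _ => ?_).trans_lt ?_
        · have := hnear b b i i
          split_ifs
          · simpa using this
          · simpa using (abs_nonneg _).trans this
        · simpa [mul_comm] using hε'
      have h3 : block E a i i = 0 ∨ block E a i i = 1 := by
        simp only [block, Matrix.diagonal_apply_eq]
        split_ifs <;> simp
      have h4 : K (block E a) i i = 0 ∨ K (block E a) i i = 1 := by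
        rcases eq_or_ne (K (block E a) i i) 0 with h | h
        · exact Or.inl h
        · exact Or.inr (mul_left_cancel₀ h (by rw [h1, mul_one]))
      rcases h3 with h3 | h3 <;> rcases h4 with h4 | h4 <;> simp [h3, h4] at h2 ⊢
    · rw [← hf, hE.diag _ _ _ hij]
      simp [block, hij]
  refine mem_holevoCone_of_near (label E) hT hS ?_ hε ?_
  · intro a b d e h
    by_contra h0
    have h1 := hKl _ (Matrix.single a b 1) (hE.apply_block a)
    rw [block_mul_single, hblock] at h1
    have h2 := hKr _ (Matrix.single a b 1) (hE.apply_block b)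
    rw [single_mul_block, hblock] at h2
    have h3 : label E a = label E d := by
      by_contra hne
      exact h0 (by rw [h1, block_mul_apply, if_neg hne])
    have h4 : label E b = label E e := by
      by_contra hne
      exact h0 (by rw [h2, mul_block_apply, if_neg hne])
    -- Rows outside the block of `a` vanish; symmetry of the value carries this over to columns.
    have h5 : label E a = label E e := by
      by_contra hne
      exact h0 (by rw [← hS, Matrix.transpose_apply, h1, block_mul_apply, if_neg hne])
    exact h ⟨h5.trans h4.symm, h3, h5⟩
  · intro a b d e _ had _
    have := hnear a b d e
    rw [hE.apply_single had] at this
    convert this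

/-! ### Kraus form, Kadison-Schwarz and the multiplicative domain -/

section Kraus

variable {n : ℕ} {Φ : Module.End ℝ (Matrix (Fin n) (Fin n) ℝ)}

theorem choi_apply (Φ : Module.End ℝ (Matrix (Fin n) (Fin n) ℝ)) (a b : Fin n × Fin n) :
    choi Φ a b = Φ (Matrix.single a.1 b.1 1) a.2 b.2 := by
  simp only [choi, Matrix.sum_apply, Matrix.kroneckerMap_apply, Matrix.single_apply, ite_and,
    ite_mul, one_mul, zero_mul]
  simp

/-- A map whose Choi matrix is positive semidefinite has a Kraus decomposition. -/
theorem exists_kraus (h : (choi Φ).PosSemidef) :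
    ∃ K : Fin n × Fin n → Matrix (Fin n) (Fin n) ℝ, ∀ X, Φ X = ∑ m, (K m)ᵀ * X * K m := by
  obtain ⟨C, hC⟩ : ∃ C : Matrix (Fin n × Fin n) (Fin n × Fin n) ℝ, choi Φ = Cᴴ * C := by
    open scoped MatrixOrder in
    exact CStarAlgebra.nonneg_iff_eq_star_mul_self.mp h.nonneg
  -- Each row of the factor `C` of the Choi matrix, reshaped into a square matrix, is a Kraus
  -- operator.
  refine ⟨fun m => Matrix.of fun i k => C m (i, k), fun X => ?_⟩
  have key : Φ = ∑ m, LinearMap.mulRight ℝ (Matrix.of fun i k => C m (i, k)) ∘ₗ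
      LinearMap.mulLeft ℝ (Matrix.of fun i k => C m (i, k))ᵀ := by
    refine Matrix.ext_linearMap ℝ fun i j => LinearMap.ext_ring ?_
    ext k l
    have := congrFun (congrFun hC (i, k)) (j, l)
    rw [choi_apply] at this
    change Φ (Matrix.single i j 1) k l = _
    rw [this]
    change _ = (∑ m, LinearMap.mulRight ℝ (Matrix.of fun i k => C m (i, k)) ∘ₗ
      LinearMap.mulLeft ℝ (Matrix.of fun i k => C m (i, k))ᵀ) (Matrix.single i j 1) k l
    simp [Matrix.mul_apply, Matrix.sum_apply, LinearMap.sum_apply, Matrix.single_apply, ite_and]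
  conv_lhs => rw [key]
  simp [LinearMap.sum_apply]

/-- The transpose of a Kraus map. -/
theorem kraus_transpose {ι : Type*} [Fintype ι] {K : ι → Matrix (Fin n) (Fin n) ℝ}
    (hK : ∀ X, Φ X = ∑ m, (K m)ᵀ * X * K m) (X : Matrix (Fin n) (Fin n) ℝ) :
    Φ Xᵀ = (Φ X)ᵀ := by
  simp [hK, Matrix.transpose_sum, Matrix.mul_assoc]

/-- The defect in the Kadison-Schwarz inequality, as a sum of squares. -/
theorem kraus_schwarz {ι : Type*} [Fintype ι] {K : ι → Matrix (Fin n) (Fin n) ℝ}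
    (hK : ∀ X, Φ X = ∑ m, (K m)ᵀ * X * K m) (h1 : Φ 1 = 1) (x : Matrix (Fin n) (Fin n) ℝ) :
    Φ (xᵀ * x) - (Φ x)ᵀ * Φ x =
      ∑ m, (x * K m - K m * Φ x)ᵀ * (x * K m - K m * Φ x) := by
  -- The factor 1 in the last term is kept so that summation over `m` produces `Φ 1 = 1`.
  have e : ∀ m, (x * K m - K m * Φ x)ᵀ * (x * K m - K m * Φ x) =
      (K m)ᵀ * (xᵀ * x) * K m - ((K m)ᵀ * xᵀ * K m) * Φ x - (Φ x)ᵀ * ((K m)ᵀ * x * K m) +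
        (Φ x)ᵀ * ((K m)ᵀ * 1 * K m) * Φ x := by
    intro m
    simp only [Matrix.transpose_sub, Matrix.transpose_mul]
    noncomm_ring
  simp only [e, Finset.sum_add_distrib, Finset.sum_sub_distrib, ← Finset.sum_mul,
    ← Finset.mul_sum, ← hK, h1, kraus_transpose hK]
  noncomm_ring

theorem trace_transpose_mul_self_nonneg (x : Matrix (Fin n) (Fin n) ℝ) : 0 ≤ (xᵀ * x).trace := by
  simp only [Matrix.trace, Matrix.diag, Matrix.mul_apply, Matrix.transpose_apply]
  exact Finset.sum_nonneg fun i _ => Finset.sum_nonneg fun j _ => mul_self_nonneg _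

/-- The trace of the Kadison-Schwarz defect is a sum of squared norms, and trace preservation
replaces `Φ (xᵀ * x)` by `xᵀ * x`. -/
theorem kraus_contraction {ι : Type*} [Fintype ι] {K : ι → Matrix (Fin n) (Fin n) ℝ}
    (hK : ∀ X, Φ X = ∑ m, (K m)ᵀ * X * K m) (h1 : Φ 1 = 1) (ht : ∀ X, (Φ X).trace = X.trace)
    (x : Matrix (Fin n) (Fin n) ℝ) : ((Φ x)ᵀ * Φ x).trace ≤ (xᵀ * x).trace := by
  have := congrArg Matrix.trace (kraus_schwarz hK h1 x)
  rw [Matrix.trace_sub, ht, Matrix.trace_sum] at this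
  have h : 0 ≤ ∑ m, ((x * K m - K m * Φ x)ᵀ * (x * K m - K m * Φ x)).trace :=
    Finset.sum_nonneg fun m _ => trace_transpose_mul_self_nonneg _
  linarith

/-- The equality case: an element whose Hilbert-Schmidt norm is preserved lies in the
multiplicative domain. -/
theorem kraus_intertwine {ι : Type*} [Fintype ι] {K : ι → Matrix (Fin n) (Fin n) ℝ}
    (hK : ∀ X, Φ X = ∑ m, (K m)ᵀ * X * K m) (h1 : Φ 1 = 1) (ht : ∀ X, (Φ X).trace = X.trace)
    {x : Matrix (Fin n) (Fin n) ℝ} (hx : ((Φ x)ᵀ * Φ x).trace = (xᵀ * x).trace) (m : ι) :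
    x * K m = K m * Φ x := by
  have := congrArg Matrix.trace (kraus_schwarz hK h1 x)
  rw [Matrix.trace_sub, ht, Matrix.trace_sum, hx, sub_self] at this
  have h := (Finset.sum_eq_zero_iff_of_nonneg
    fun m _ => trace_transpose_mul_self_nonneg (x * K m - K m * Φ x)).mp this.symm m
      (Finset.mem_univ m)
  have h2 := Matrix.trace_conjTranspose_mul_self_eq_zero_iff.mp
    ((congrArg (fun A => (A * (x * K m - K m * Φ x)).trace)
      (Matrix.conjTranspose_eq_transpose_of_trivial (x * K m - K m * Φ x))).trans h)
  exact sub_eq_zero.mp h2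

theorem kraus_map_mul_right {ι : Type*} [Fintype ι] {K : ι → Matrix (Fin n) (Fin n) ℝ}
    (hK : ∀ X, Φ X = ∑ m, (K m)ᵀ * X * K m) {x : Matrix (Fin n) (Fin n) ℝ}
    (hx : ∀ m, x * K m = K m * Φ x) (y : Matrix (Fin n) (Fin n) ℝ) :
    Φ (y * x) = Φ y * Φ x := by
  rw [hK (y * x), hK y, Finset.sum_mul]
  refine Finset.sum_congr rfl fun m _ => ?_
  simp only [Matrix.mul_assoc, hx]

/-- The transpose exchanges left and right multiplication, and a symmetric `x` is its own transpose.
-/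
theorem kraus_map_mul_left {ι : Type*} [Fintype ι] {K : ι → Matrix (Fin n) (Fin n) ℝ}
    (hK : ∀ X, Φ X = ∑ m, (K m)ᵀ * X * K m) {x : Matrix (Fin n) (Fin n) ℝ}
    (hx : ∀ m, x * K m = K m * Φ x) (hs : xᵀ = x) (y : Matrix (Fin n) (Fin n) ℝ) :
    Φ (x * y) = Φ x * Φ y := by
  have h := kraus_map_mul_right hK hx yᵀ
  have h2 := congrArg Matrix.transpose h
  rw [← kraus_transpose hK, Matrix.transpose_mul, Matrix.transpose_mul, hs,
    Matrix.transpose_transpose, ← kraus_transpose hK, ← kraus_transpose hK, hs,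
    Matrix.transpose_transpose] at h2
  exact h2

end Kraus

/-- A real map is transpose invariant if its Choi matrix is invariant under partial transpose. -/
theorem map_transpose_of_partialTranspose_choi {n : ℕ}
    {Φ : Module.End ℝ (Matrix (Fin n) (Fin n) ℝ)} (h : partialTranspose (choi Φ) = choi Φ)
    (X : Matrix (Fin n) (Fin n) ℝ) : Φ Xᵀ = Φ X := by
  have h1 : ∀ i j, Φ (Matrix.single j i 1) = Φ (Matrix.single i j 1) := by
    intro i j
    ext k l
    have := congrFun (congrFun h (i, k)) (j, l)
    rw [choi_apply] at this
    rw [← this]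
    simp [partialTranspose, choi_apply]
  have key : Φ ∘ₗ (Matrix.transposeLinearEquiv (Fin n) (Fin n) ℝ ℝ).toLinearMap = Φ := by
    refine Matrix.ext_linearMap ℝ fun i j => LinearMap.ext_ring ?_
    simpa using h1 i j
  exact LinearMap.congr_fun key X

/-! ### Idempotent limits of powers -/

section Limit

open scoped Matrix.Norms.Frobenius
open Filter Topology

variable {n : ℕ}

theorem frobenius_norm_sq (x : Matrix (Fin n) (Fin n) ℝ) : ‖x‖ ^ 2 = (xᵀ * x).trace := by
  rw [Matrix.frobenius_norm_def, ← Real.rpow_natCast, ← Real.rpow_mul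
    (Finset.sum_nonneg fun i _ => Finset.sum_nonneg fun j _ => by positivity)]
  simp only [Matrix.trace, Matrix.diag, Matrix.mul_apply, Matrix.transpose_apply]
  rw [Finset.sum_comm]
  norm_num [sq]

/-- The powers of a contraction accumulate at an idempotent. -/
theorem exists_idempotent_mem_closure_powers {V : Type*} [NormedAddCommGroup V] [NormedSpace ℝ V]
    [FiniteDimensional ℝ V] {T : V →L[ℝ] V} (hT : ‖T‖ ≤ 1) :
    ∃ E ∈ closure {S | ∃ k : ℕ, 1 ≤ k ∧ S = T ^ k}, E * E = E := by
  have : ProperSpace (V →L[ℝ] V) := FiniteDimensional.proper ℝ _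
  -- The Ellis-Numakura lemma: the closure of the positive powers is a compact semigroup.
  refine exists_idempotent_in_compact_subsemigroup (fun r => continuous_mul_const r) _ ?_ ?_ ?_
  · exact ⟨T, subset_closure ⟨1, le_rfl, (pow_one T).symm⟩⟩
  · refine (isCompact_closedBall (0 : V →L[ℝ] V) 1).of_isClosed_subset isClosed_closure
      (closure_minimal ?_ Metric.isClosed_closedBall)
    rintro _ ⟨k, hk, rfl⟩
    rw [mem_closedBall_zero_iff]
    exact (norm_pow_le' T hk).trans (pow_le_one₀ (norm_nonneg _) hT)
  · intro x hx y hy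
    refine map_mem_closure₂ continuous_mul hx hy ?_
    rintro _ ⟨k, hk, rfl⟩ _ ⟨l, hl, rfl⟩
    exact ⟨k + l, by omega, (pow_add T k l).symm⟩

/-- The powers of a linear contraction converge to an idempotent along a sequence. -/
theorem exists_idempotent_tendsto_pow {V : Type*} [NormedAddCommGroup V] [NormedSpace ℝ V]
    [FiniteDimensional ℝ V] {T : Module.End ℝ V} (hT : ∀ x, ‖T x‖ ≤ ‖x‖) :
    ∃ (E : Module.End ℝ V) (φ : ℕ → ℕ), (∀ x, E (E x) = E x) ∧ (∀ j, 1 ≤ φ j) ∧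
      ∀ x, Tendsto (fun j => (T ^ φ j) x) atTop (𝓝 (E x)) := by
  let S : V →L[ℝ] V := LinearMap.toContinuousLinearMap T
  have hS : ‖S‖ ≤ 1 := S.opNorm_le_bound zero_le_one fun x => by rw [one_mul]; exact hT x
  have hpow : ∀ (k : ℕ) x, (S ^ k) x = (T ^ k) x := by
    intro k
    induction k with
    | zero => intro x; rfl
    | succ k ih => intro x; rw [pow_succ, pow_succ]; exact ih _
  obtain ⟨E, hE, hEE⟩ := exists_idempotent_mem_closure_powers hS
  obtain ⟨u, hu, hlim⟩ := mem_closure_iff_seq_limit.mp hE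
  choose φ hφ hφu using hu
  refine ⟨E.toLinearMap, φ, fun x => congrArg (fun S => S x) hEE, hφ, fun x => ?_⟩
  have := ((ContinuousLinearMap.apply ℝ V x).continuous.tendsto E).comp hlim
  refine this.congr fun j => ?_
  change u j x = _
  rw [hφu, hpow]

end Limit

/-! ### Simultaneous diagonalization and change of basis -/

/-- A commuting family of real symmetric matrices is diagonalized by an orthogonal matrix. -/
theorem exists_orthogonal_diagonalizing {n : ℕ} (V : Set (Matrix (Fin n) (Fin n) ℝ))
    (hs : ∀ x ∈ V, xᵀ = x) (hc : ∀ x ∈ V, ∀ y ∈ V, x * y = y * x) :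
    ∃ U : Matrix (Fin n) (Fin n) ℝ, Uᵀ * U = 1 ∧
      ∀ x ∈ V, ∀ a b, a ≠ b → (Uᵀ * x * U) a b = 0 := by
  classical
  let T : V → Module.End ℝ (EuclideanSpace ℝ (Fin n)) := fun x => Matrix.toEuclideanLin x.1
  have hT : ∀ x, (T x).IsSymmetric := fun x =>
    Matrix.isSymmetric_toEuclideanLin_iff.mpr
      ((Matrix.conjTranspose_eq_transpose_of_trivial x.1).trans (hs x.1 x.2))
  have hmul : ∀ x y : V, T x * T y = Matrix.toEuclideanLin (x.1 * y.1) := by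
    intro x y
    ext v i
    simp [T, Matrix.toLpLin_apply, Matrix.mulVec_mulVec]
  have hC : Pairwise (Function.onFun Commute T) := by
    intro x y _
    change T x * T y = T y * T x
    rw [hmul, hmul, hc x.1 x.2 y.1 y.2]
  have hI := LinearMap.IsSymmetric.directSum_isInternal_of_pairwise_commute hT hC
  have hO := LinearMap.IsSymmetric.orthogonalFamily_iInf_eigenspaces hT
  -- The family may be infinite, but only finitely many joint eigenspaces are nonzero; restricting
  -- to these allows an orthonormal basis subordinate to them.
  have hI' := DirectSum.isInternal_ne_bot_iff.mpr hI
  have hO' := hO.comp (Subtype.val_injective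
    (p := fun χ : V → ℝ => (⨅ j, Module.End.eigenspace (T j) (χ j)) ≠ ⊥))
  let _ := hI.submodule_iSupIndep.fintypeNeBotOfFiniteDimensional
  have hn : Module.finrank ℝ (EuclideanSpace ℝ (Fin n)) = n := by simp
  let B := hI'.subordinateOrthonormalBasis hn hO'
  have hB : ∀ a, ∃ χ : V → ℝ, ∀ x, T x (B a) = χ x • B a := by
    intro a
    have := hI'.subordinateOrthonormalBasis_subordinate hn a hO'
    rw [Submodule.mem_iInf] at this
    exact ⟨_, fun x => Module.End.mem_eigenspace_iff.mp (this x)⟩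
  choose χ hχ using hB
  let U : Matrix (Fin n) (Fin n) ℝ := Matrix.of fun i a => B a i
  have hU : Uᵀ * U = 1 := by
    ext a b
    have := (orthonormal_iff_ite.mp B.orthonormal) b a
    rw [PiLp.inner_apply] at this
    simpa [U, Matrix.mul_apply, Matrix.one_apply, eq_comm] using this
  refine ⟨U, hU, fun x hx a b hab => ?_⟩
  have hxU : x * U = U * Matrix.diagonal fun a => χ a ⟨x, hx⟩ := by
    ext i a
    have := congrArg (fun v : EuclideanSpace ℝ (Fin n) => v i) (hχ a ⟨x, hx⟩)
    rw [Matrix.mul_diagonal]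
    simpa [T, U, Matrix.toLpLin_apply, Matrix.mulVec, dotProduct, Matrix.mul_apply,
      mul_comm] using this
  rw [Matrix.mul_assoc, hxU, ← Matrix.mul_assoc, hU, one_mul, Matrix.diagonal_apply_ne _ hab]

/-- Conjugation of a map on matrices by an orthogonal matrix. -/
def orthConj {n : ℕ} (U : Matrix (Fin n) (Fin n) ℝ)
    (Ψ : Module.End ℝ (Matrix (Fin n) (Fin n) ℝ)) : Module.End ℝ (Matrix (Fin n) (Fin n) ℝ) :=
  (LinearMap.mulRight ℝ U ∘ₗ LinearMap.mulLeft ℝ Uᵀ) ∘ₗ Ψ ∘ₗ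
    (LinearMap.mulRight ℝ Uᵀ ∘ₗ LinearMap.mulLeft ℝ U)

theorem orthConj_apply {n : ℕ} (U : Matrix (Fin n) (Fin n) ℝ)
    (Ψ : Module.End ℝ (Matrix (Fin n) (Fin n) ℝ)) (X : Matrix (Fin n) (Fin n) ℝ) :
    orthConj U Ψ X = Uᵀ * Ψ (U * X * Uᵀ) * U := rfl

/-- If `E` is a trace preserving conditional expectation onto an algebra diagonalized by `U` and `K`
is multiplicative on that algebra and close to `E`, then `K` lies in the Holevo cone. -/
theorem mem_holevoCone_of_near_expectation {n : ℕ} {U : Matrix (Fin n) (Fin n) ℝ}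
    (hU : Uᵀ * U = 1) {K E : Module.End ℝ (Matrix (Fin n) (Fin n) ℝ)}
    (hidem : ∀ X, E (E X) = E X) (hone : E 1 = 1) (htr : ∀ X, (E X).trace = X.trace)
    (hmul : ∀ x y, E x = x → E (x * y) = x * E y)
    (hdiag : ∀ x, E x = x → ∀ a b, a ≠ b → (Uᵀ * x * U) a b = 0)
    (hT : ∀ X, K Xᵀ = K X) (hS : ∀ X, (K X)ᵀ = K X)
    (hKE : ∀ x, E x = x → E (K x) = K x)
    (hKl : ∀ x y, E x = x → K (x * y) = K x * K y)
    (hKr : ∀ x y, E x = x → K (y * x) = K y * K x)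
    {ε : ℝ} (hε : ε * (n : ℝ) ^ 3 ≤ 1) (hε' : ε * n < 1)
    (hnear : ∀ a b d e, |orthConj U K (Matrix.single a b 1) d e -
      orthConj U E (Matrix.single a b 1) d e| ≤ ε) :
    K ∈ holevoCone n := by
  have hU' : U * Uᵀ = 1 := mul_eq_one_comm.mp hU
  have c1 : ∀ A B : Matrix (Fin n) (Fin n) ℝ, Uᵀ * A * U * (Uᵀ * B * U) = Uᵀ * (A * B) * U := by
    intro A B
    calc _ = Uᵀ * A * (U * Uᵀ) * B * U := by noncomm_ring
      _ = _ := by rw [hU']; noncomm_ring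
  have c2 : ∀ A B : Matrix (Fin n) (Fin n) ℝ,
      U * (A * B) * Uᵀ = U * A * Uᵀ * (U * B * Uᵀ) := by
    intro A B
    calc _ = U * A * 1 * B * Uᵀ := by noncomm_ring
      _ = _ := by rw [← hU]; noncomm_ring
  have c3 : ∀ A : Matrix (Fin n) (Fin n) ℝ, U * (Uᵀ * A * U) * Uᵀ = A := by
    intro A
    calc _ = (U * Uᵀ) * A * (U * Uᵀ) := by noncomm_ring
      _ = _ := by rw [hU']; noncomm_ring
  have c4 : ∀ A : Matrix (Fin n) (Fin n) ℝ, Uᵀ * (U * A * Uᵀ) * U = A := by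
    intro A
    calc _ = (Uᵀ * U) * A * (Uᵀ * U) := by noncomm_ring
      _ = _ := by rw [hU]; noncomm_ring
  have c5 : ∀ {x}, orthConj U E x = x → E (U * x * Uᵀ) = U * x * Uᵀ := by
    intro x hx
    rw [orthConj_apply] at hx
    conv_rhs => rw [← hx, c3]
  have hE : IsDiagExpectation (orthConj U E) := by
    refine ⟨fun X => ?_, ?_, fun X => ?_, fun X a b hab => ?_, fun x y hx => ?_⟩
    · rw [orthConj_apply, orthConj_apply, c3, hidem]
    · rw [orthConj_apply, mul_one, hU', hone, mul_one, hU]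
    · rw [orthConj_apply, Matrix.trace_mul_comm, ← Matrix.mul_assoc, hU', one_mul, htr,
        Matrix.trace_mul_comm, ← Matrix.mul_assoc, hU, one_mul]
    · exact hdiag _ (hidem _) a b hab
    · rw [orthConj_apply, c2, hmul _ _ (c5 hx), ← c1, c4, orthConj_apply]
  refine mem_holevoCone_of_conj hU' (hE.mem_holevoCone (K := orthConj U K) (fun X => ?_)
    (fun X => ?_) (fun x hx => ?_) (fun x y hx => ?_) (fun x y hx => ?_) hε hε' hnear)
    (orthConj_apply U K)
  · rw [orthConj_apply, orthConj_apply, ← hT (U * X * Uᵀ)]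
    simp [Matrix.mul_assoc]
  · rw [orthConj_apply, Matrix.transpose_mul, Matrix.transpose_mul, hS]
    simp [Matrix.mul_assoc]
  · rw [orthConj_apply, orthConj_apply, c3, hKE _ (c5 hx)]
  · rw [orthConj_apply, c2, hKl _ _ (c5 hx), ← c1, orthConj_apply, orthConj_apply]
  · rw [orthConj_apply, c2, hKr _ _ (c5 hx), ← c1, orthConj_apply, orthConj_apply]

/-! ### A power in the Holevo cone -/

section Limit

open scoped Matrix.Norms.Frobenius
open Filter Topology

/-- Some power of a unital trace preserving map in Kraus form which is invariant under the
transpose lies in the Holevo cone. -/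
theorem exists_pow_mem_holevoCone {n : ℕ} {Φ : Module.End ℝ (Matrix (Fin n) (Fin n) ℝ)}
    {ι : Type*} [Fintype ι] {K : ι → Matrix (Fin n) (Fin n) ℝ}
    (hK : ∀ X, Φ X = ∑ m, (K m)ᵀ * X * K m) (h1 : Φ 1 = 1) (ht : ∀ X, (Φ X).trace = X.trace)
    (hT : ∀ X, Φ Xᵀ = Φ X) : ∃ k : ℕ, 1 ≤ k ∧ Φ ^ k ∈ holevoCone n := by
  have hS : ∀ X, (Φ X)ᵀ = Φ X := fun X => by rw [← kraus_transpose hK, hT]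
  have hcontr : ∀ X, ‖Φ X‖ ≤ ‖X‖ := fun X =>
    le_of_sq_le_sq (by rw [frobenius_norm_sq, frobenius_norm_sq]
                       exact kraus_contraction hK h1 ht X) (norm_nonneg _)
  have hcontr_pow : ∀ (k : ℕ) X, ‖(Φ ^ k) X‖ ≤ ‖X‖ := by
    intro k
    induction k with
    | zero => intro X; exact le_rfl
    | succ k ih => intro X; rw [pow_succ]; exact (ih _).trans (hcontr X)
  obtain ⟨E, φ, hidem, hφ, hlim'⟩ := exists_idempotent_tendsto_pow hcontr
  have hlim : ∀ X, Tendsto (fun j => (Φ ^ φ j) X) atTop (𝓝 (E X)) := hlim'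
  have hpow_one : ∀ k : ℕ, (Φ ^ k) 1 = 1 := by
    intro k
    induction k with
    | zero => rfl
    | succ k ih => rw [pow_succ, Module.End.mul_apply, h1, ih]
  have hpow_trace : ∀ (k : ℕ) X, ((Φ ^ k) X).trace = X.trace := by
    intro k
    induction k with
    | zero => intro X; rfl
    | succ k ih => intro X; rw [pow_succ, Module.End.mul_apply, ih, ht]
  -- The bound `1 ≤ k` matters: symmetry of the value comes from the outermost factor, and transpose
  -- invariance below from the innermost one.
  have hpow_symm : ∀ k : ℕ, 1 ≤ k → ∀ X, ((Φ ^ k) X)ᵀ = (Φ ^ k) X := by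
    intro k hk X
    obtain ⟨k, rfl⟩ := Nat.exists_eq_add_of_le' hk
    rw [pow_succ', Module.End.mul_apply, hS]
  have hpow_transpose : ∀ k : ℕ, 1 ≤ k → ∀ X, (Φ ^ k) Xᵀ = (Φ ^ k) X := by
    intro k hk X
    obtain ⟨k, rfl⟩ := Nat.exists_eq_add_of_le' hk
    rw [pow_succ, Module.End.mul_apply, Module.End.mul_apply, hT]
  have hone : E 1 = 1 := tendsto_nhds_unique (hlim 1) (by
    simp only [hpow_one]
    exact tendsto_const_nhds)
  have htr : ∀ X, (E X).trace = X.trace := fun X => by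
    refine tendsto_nhds_unique
      (((continuous_id.matrix_trace).tendsto (E X)).comp (hlim X)) ?_
    simp only [Function.comp_def, id, hpow_trace]
    exact tendsto_const_nhds
  have hsymm : ∀ X, (E X)ᵀ = E X := fun X => by
    refine tendsto_nhds_unique
      (((continuous_id.matrix_transpose).tendsto (E X)).comp (hlim X)) ?_
    simp only [Function.comp_def, id, hpow_symm _ (hφ _)]
    exact hlim X
  have hΦc : Continuous Φ := LinearMap.continuous_of_finiteDimensional Φ
  have hcomm : ∀ X, E (Φ X) = Φ (E X) := fun X => by
    refine tendsto_nhds_unique (hlim (Φ X)) (((hΦc.tendsto (E X)).comp (hlim X)).congr fun j => ?_)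
    rw [Function.comp_apply, ← Module.End.mul_apply, ← Module.End.mul_apply, ← pow_succ,
      ← pow_succ']
  have hV : ∀ x, E x = x → E (Φ x) = Φ x := fun x hx => by rw [hcomm, hx]
  have hVpow : ∀ (k : ℕ) x, E x = x → E ((Φ ^ k) x) = (Φ ^ k) x := by
    intro k
    induction k with
    | zero => intro x hx; exact hx
    | succ k ih => intro x hx; rw [pow_succ]; exact ih _ (hV x hx)
  have hVs : ∀ x, E x = x → xᵀ = x := fun x hx => by rw [← hx, hsymm]
  have hiso : ∀ x, E x = x → ∀ m, x * K m = K m * Φ x := by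
    intro x hx
    refine kraus_intertwine hK h1 ht ?_
    -- Every power in the sequence factors through `Φ`, and the remaining factors are contractions.
    have h2 : ‖E x‖ ≤ ‖Φ x‖ := le_of_tendsto (hlim' x).norm (Eventually.of_forall fun j => by
      obtain ⟨k, hk⟩ := Nat.exists_eq_add_of_le' (hφ j)
      rw [hk, pow_succ]
      exact hcontr_pow k _)
    rw [hx] at h2
    rw [← frobenius_norm_sq, ← frobenius_norm_sq, le_antisymm (hcontr x) h2]
  have hmulr : ∀ (k : ℕ) x y, E x = x → (Φ ^ k) (y * x) = (Φ ^ k) y * (Φ ^ k) x := by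
    intro k
    induction k with
    | zero => intro x y _; rfl
    | succ k ih =>
      intro x y hx
      simp only [pow_succ, Module.End.mul_apply]
      rw [kraus_map_mul_right hK (hiso x hx), ih _ _ (hV x hx)]
  have hmull : ∀ (k : ℕ) x y, E x = x → (Φ ^ k) (x * y) = (Φ ^ k) x * (Φ ^ k) y := by
    intro k
    induction k with
    | zero => intro x y _; rfl
    | succ k ih =>
      intro x y hx
      simp only [pow_succ, Module.End.mul_apply]
      rw [kraus_map_mul_left hK (hiso x hx) (hVs x hx), ih _ _ (hV x hx)]
  have hEmul : ∀ x y, E x = x → E (x * y) = x * E y := by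
    intro x y hx
    have := tendsto_nhds_unique (hlim (x * y)) (((hlim x).mul (hlim y)).congr fun j =>
      (hmull (φ j) x y hx).symm)
    rwa [hx] at this
  -- For `x`, `y` in the range, `x * y = E (x * y)` is symmetric, so it equals `y * x`.
  obtain ⟨U, hU, hUd⟩ := exists_orthogonal_diagonalizing {x | E x = x} hVs (by
    intro x hx y hy
    have hx' : E x = x := hx
    have hy' : E y = y := hy
    have h := hsymm (x * y)
    rw [hEmul x y hx', hy', Matrix.transpose_mul, hVs x hx', hVs y hy'] at h
    exact h.symm)
  -- With `n + 1` in place of `n`, both `ε * n ^ 3 ≤ 1` and the strict bound `ε * n < 1` hold,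
  -- including for `n = 0`.
  set ε : ℝ := ((n : ℝ) + 1)⁻¹ ^ 3 with hε
  have hn0 : (0 : ℝ) ≤ n := Nat.cast_nonneg n
  have hε0 : 0 < ε := by positivity
  have hnear : ∀ᶠ j in atTop, ∀ a b d e, |orthConj U (Φ ^ φ j) (Matrix.single a b 1) d e -
      orthConj U E (Matrix.single a b 1) d e| < ε := by
    simp only [Filter.eventually_all]
    intro a b d e
    have hc : Continuous fun X : Matrix (Fin n) (Fin n) ℝ => (Uᵀ * X * U) d e :=
      ((continuous_const.matrix_mul continuous_id).matrix_mul continuous_const).matrix_elem d e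
    have hd : Tendsto (fun j => orthConj U (Φ ^ φ j) (Matrix.single a b 1) d e) atTop
        (𝓝 (orthConj U E (Matrix.single a b 1) d e)) := by
      simp only [orthConj_apply]
      generalize U * Matrix.single a b 1 * Uᵀ = Y
      exact (hc.tendsto (E Y)).comp (hlim Y)
    simpa only [Real.dist_eq] using Metric.tendsto_nhds.mp hd ε hε0
  obtain ⟨j, hj⟩ := hnear.exists
  refine ⟨φ j, hφ j, mem_holevoCone_of_near_expectation hU hidem hone htr hEmul hUd
    (hpow_transpose _ (hφ j)) (hpow_symm _ (hφ j)) (hVpow _) (hmull _) (hmulr _) (ε := ε) ?_ ?_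
    fun a b d e => (hj a b d e).le⟩
  · rw [hε, ← mul_pow]
    refine pow_le_one₀ (by positivity) ?_
    rw [inv_mul_le_iff₀ (by positivity)]
    linarith
  · rw [hε, inv_pow, inv_mul_lt_iff₀ (by positivity)]
    rw [mul_one]
    exact (lt_add_one _).trans_le (le_self_pow₀ (by linarith) (by norm_num))

end Limit

end RealIPT

theorem mainTheorem8 (n : ℕ)
    (Φ : Matrix (Fin n) (Fin n) ℝ →ₗ[ℝ] Matrix (Fin n) (Fin n) ℝ)
    (hunital : Φ 1 = 1)
    (htrace : ∀ X : Matrix (Fin n) (Fin n) ℝ, (Φ X).trace = X.trace)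
    (hIPT : RealIPT.IsIPT Φ) :
    ∃ k : ℕ, 1 ≤ k ∧ RealIPT.IsEntanglementBreaking (Φ ^ k) := by
  obtain ⟨K, hK⟩ := RealIPT.exists_kraus hIPT.2.1
  obtain ⟨k, hk, h⟩ := RealIPT.exists_pow_mem_holevoCone hK hunital htrace
    (RealIPT.map_transpose_of_partialTranspose_choi hIPT.2.2)
  exact ⟨k, hk, RealIPT.isEntanglementBreaking_of_mem_holevoCone h⟩
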